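/- Let $\Gamma$ be a finite group and $G=(V,E)$ a finite simple graph with a labelling $\lambda$ of its oriented edges by elements of $\Gamma$ such that $\lambda(u,v)\lambda(v,u)=1_\Gamma$ for every edge $uv$; let $t\in V$. For a simple path $P=v_1\dots v_r$ put $\lambda(P)=\lambda(v_1,v_2)\cdots\lambda(v_{r-1},v_r)$. *Double path system.* A double path ending in $v\in V$ is a pair $(P_a,P_b)$ of simple paths from $t$ to $v$ with $\lambda(P_a)\neq\lambda(P_b)$. For $z\in\mathbb R_{\ge 0}^V$, let $z(P)$ be the sum of $z(u)$ over the internal vertices $u$ of $P$. The double path system is the linear program $$\min \sum_{v\in V} z(v)\quad\text{s.t. } z\ge 0,\qquad z(P_a)+z(P_b)+z(v)\ge 1\ \text{ for every } v\in V \text{ and every double path } (P_a,P_b) \text{ ending in } v .$$ *Half-integral Group Feedback Vertex Set (GFVS) with the assignment $t=1_\Gamma$.* There is one variable for each occurrence $(u,e)$ of a vertex $u$ in an edge $e\ni u$. A feasible solution is a map $\varphi$ from the occurrences to $\Gamma\cup\{0\}$ (where $0\notin\Gamma$ is a relaxed value) such that every occurrence of $t$ has value $1_\Gamma$ and, for every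 edge $e=uv$, either $\varphi(u,e)=\varphi(v,e)=0$ or both are in $\Gamma$ and $\varphi(u,e)\lambda(u,v)=\varphi(v,e)$. The cost $c_\varphi(v)$ of a vertex $v$ is $1$ if two occurrences of $v$ have distinct values in $\Gamma$; otherwise it is $\tfrac12$ if some occurrence of $v$ has a value in $\Gamma$ and another has value $0$; otherwise it is $0$. An optimal solution is a feasible $\varphi$ that minimises $\sum_{v\in V} c_\varphi(v)$. **Lemma.** The double path system has a half-integral optimum, i.e. an optimum $z$ with $z(v)\in\{0,\tfrac12,1\}$ for all $v\in V$. Moreover, every such half-integral optimum $z$ can be converted into an optimal solution $\varphi$ of half-integral GFVS with the assignment $t=1_\Gamma$, with $c_\varphi(v)=z(v)$ for every $v\in V$, as follows: give every occurrence of $t$ the value $1_\Gamma$; exhaustively propagate values along each edge $e=uv$ (from $\gamma$ at $(u,e)$ to $\gamma\lambda(u,v)$ at $(v,e)$) and, for each vertex $v$ with $z(v)=0$, from each occurrence of $v$ to all other occurrences of $v$; this never forces two different values on the same occurrence; give value $0$ to every occurrence that receives no value. -/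

import Mathlib

noncomputable section

namespace GroupFVS

open scoped Classical in
/-- The relaxation, on the domain `Γ ∪ {0}`, of the soft version of the bijection constraint
`a * g = b`: cost `0` if it holds (in particular at `(0, 0)`), cost `1/2` if exactly one of the two
values is the relaxed value `0`, and cost `1` otherwise. -/
def relaxedBijection {Γ : Type*} [Group Γ] (g : Γ) (a b : WithZero Γ) : ℝ :=
  if a * (g : WithZero Γ) = b then 0 else if a = 0 ∨ b = 0 then 1 / 2 else 1

open scoped Classical in
/-- The relaxation, on the domain `Γ ∪ {0}`, of the soft wide equality `x₁ = ⋯ = x_r`: cost `1` if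
the tuple contains two distinct integral values, cost `1/2` if it does not, but contains both an
integral value and the value `0`, and cost `0` if it is constant. -/
def relaxedWideEquality {Γ : Type*} {ι : Type*} (x : ι → WithZero Γ) : ℝ :=
  if ∃ i j, x i ≠ 0 ∧ x j ≠ 0 ∧ x i ≠ x j then 1
  else if ∃ i j, x i ≠ 0 ∧ x j = 0 then 1 / 2 else 0

/-- `lam (u, v)` and `lam (v, u)` are inverse to each other for every edge `uv`. -/
def IsLabelling {V Γ : Type*} [Group Γ] {G : SimpleGraph V} (lam : G.Dart → Γ) : Prop :=
  ∀ d : G.Dart, lam d * lam d.symm = 1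

/-- The label of a walk: the product, in order, of the labels of its (oriented) edges. -/
def walkLabel {V Γ : Type*} [Group Γ] {G : SimpleGraph V} (lam : G.Dart → Γ) {u v : V}
    (p : G.Walk u v) : Γ :=
  (p.darts.map lam).prod

/-- The total weight of the internal vertices of a path. -/
def innerWeight {V : Type*} {G : SimpleGraph V} (z : V → ℝ) {u v : V} (p : G.Walk u v) : ℝ :=
  (p.support.tail.dropLast.map z).sum

/-- A double path ending in `v`: two paths from `t` to `v` with different labels. -/
def IsDoublePath {V Γ : Type*} [Group Γ] {G : SimpleGraph V} (lam : G.Dart → Γ) {t v : V}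
    (Pa Pb : G.Walk t v) : Prop :=
  Pa.IsPath ∧ Pb.IsPath ∧ walkLabel lam Pa ≠ walkLabel lam Pb

/-- Every double path has length at least `1`. -/
def DoublePathHitting {V Γ : Type*} [Group Γ] {G : SimpleGraph V} (lam : G.Dart → Γ) (t : V)
    (z : V → ℝ) : Prop :=
  ∀ (v : V) (Pa Pb : G.Walk t v), IsDoublePath lam Pa Pb →
    1 ≤ innerWeight z Pa + innerWeight z Pb + z v

/-- The feasible points of the double path system. -/
def DoublePathFeasible {V Γ : Type*} [Group Γ] {G : SimpleGraph V} (lam : G.Dart → Γ) (t : V)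
    (z : V → ℝ) : Prop :=
  (∀ v, 0 ≤ z v) ∧ DoublePathHitting lam t z

/-- `z` is an optimum of the double path system: minimise `∑ v, z v` over the feasible points. -/
def DoublePathOptimum {V Γ : Type*} [Fintype V] [Group Γ] {G : SimpleGraph V}
    (lam : G.Dart → Γ) (t : V) (z : V → ℝ) : Prop :=
  DoublePathFeasible lam t z ∧ ∀ z', DoublePathFeasible lam t z' → ∑ v, z v ≤ ∑ v, z' v

def HalfIntegral {V : Type*} (z : V → ℝ) : Prop :=
  ∀ v, z v = 0 ∨ z v = 1 / 2 ∨ z v = 1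

/-! In the relaxed problem every vertex is split into one variable for each of its occurrences in
an edge. The dart `d = (u, v)` stands for the occurrence of `u` in the edge `uv`; the other
variable of that edge, the occurrence of `v`, is then `d.symm`. -/

/-- The crisp constraints: every occurrence of `t` has the value `1`, and the relaxed edge
constraints are satisfied (at cost zero). -/
def RelaxedFeasible {V Γ : Type*} [Group Γ] {G : SimpleGraph V} (lam : G.Dart → Γ) (t : V)
    (φ : G.Dart → WithZero Γ) : Prop :=
  (∀ d : G.Dart, d.fst = t → φ d = ((1 : Γ) : WithZero Γ)) ∧
    ∀ d : G.Dart, relaxedBijection (lam d) (φ d) (φ d.symm) = 0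

/-- The cost of the relaxed soft equality of all occurrences of the vertex `v`. -/
def deletionCost {V Γ : Type*} {G : SimpleGraph V} (φ : G.Dart → WithZero Γ) (v : V) : ℝ :=
  relaxedWideEquality fun d : {d : G.Dart // d.fst = v} => φ d.1

/-- `φ` is an optimal solution of the half-integral relaxation. -/
def RelaxedOptimum {V Γ : Type*} [Fintype V] [Group Γ] {G : SimpleGraph V}
    (lam : G.Dart → Γ) (t : V) (φ : G.Dart → WithZero Γ) : Prop :=
  RelaxedFeasible lam t φ ∧
    ∀ φ', RelaxedFeasible lam t φ' → ∑ v, deletionCost φ v ≤ ∑ v, deletionCost φ' v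

/-- The values forced on the occurrences by the assignment `t = 1`, when values are propagated
through edges and through vertices that are not deleted at all, but not through (partially or
fully) deleted vertices. -/
inductive Propagates {V Γ : Type*} [Group Γ] {G : SimpleGraph V} (lam : G.Dart → Γ) (t : V)
    (z : V → ℝ) : G.Dart → Γ → Prop
  | start (d : G.Dart) : d.fst = t → Propagates lam t z d 1
  | edge (d : G.Dart) (γ : Γ) : Propagates lam t z d γ → Propagates lam t z d.symm (γ * lam d)
  | vertex (d d' : G.Dart) (γ : Γ) : Propagates lam t z d γ → d'.fst = d.fst → z d.fst = 0 →
      Propagates lam t z d' γ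

end GroupFVS

end

noncomputable section

namespace GroupFVS

open SimpleGraph

/-! ### Labels and weights of walks; the start vertex is weightless for the double path system. -/

section Walks

variable {V Γ : Type*} [Group Γ] {G : SimpleGraph V} {lam : G.Dart → Γ}

/-! The two problems have the same optimal value, and each side is rounded into the other.

From GFVS to double paths (`RelaxedFeasible.doublePathFeasible`): the costs of any relaxed solution
hit every double path. If one had length below `1`, half-integrality would leave at most one charged
vertex on it, of cost `1/2`. Integral values then travel from `t` along both paths and must agree
where they meet, so the labels coincide.

From double paths to GFVS (`exists_relaxedFeasible_sum_le`): normalise `z t = 0` and take a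
threshold `θ < 1/2`. Two paths to the same vertex of weight at most `θ` each cannot form a double
path, so the light vertices get well-defined values. Pushing these through edges and relaxing all
other occurrences gives a feasible assignment. For `θ` uniform in `[0, 1/2)` the expected cost of
`v` is at most `z v`, so some `θ` gives total cost at most `∑ v, z v`.

Composing the two roundings turns any feasible point into a half-integral one that costs no more;
only finitely many of those exist, so an optimum exists. For a half-integral optimum, `θ = 0`
already gives costs at most `z` pointwise, with equality by optimality, and the values forced at `θ
= 0` are exactly the propagated ones. -/

@[simp]
theorem walkLabel_nil {u : V} : walkLabel lam (Walk.nil : G.Walk u u) = 1 := by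
  simp [walkLabel]

@[simp]
theorem walkLabel_cons {u v w : V} (h : G.Adj u v) (p : G.Walk v w) :
    walkLabel lam (p.cons h) = lam ⟨(u, v), h⟩ * walkLabel lam p := by
  simp [walkLabel]

theorem walkLabel_append {u v w : V} (p : G.Walk u v) (q : G.Walk v w) :
    walkLabel lam (p.append q) = walkLabel lam p * walkLabel lam q := by
  simp [walkLabel]

theorem walkLabel_concat {u v w : V} (p : G.Walk u v) (h : G.Adj v w) :
    walkLabel lam (p.concat h) = walkLabel lam p * lam ⟨(v, w), h⟩ := by
  simp [walkLabel, Walk.darts_concat]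

theorem IsLabelling.mul_symm_cancel (hlam : IsLabelling lam) (γ : Γ) (d : G.Dart) :
    γ * lam d * lam d.symm = γ := by
  rw [mul_assoc, hlam d, mul_one]

theorem IsLabelling.mul_symm_cancel' (hlam : IsLabelling lam) (γ : Γ) (d : G.Dart) :
    γ * lam d.symm * lam d = γ := by
  simpa using hlam.mul_symm_cancel γ d.symm

theorem walkLabel_reverse (hlam : IsLabelling lam) {u v : V} (p : G.Walk u v) :
    walkLabel lam p.reverse = (walkLabel lam p)⁻¹ := by
  induction p with
  | nil => simp
  | @cons u v w h p ih =>
    have h1 := hlam ⟨(u, v), h⟩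
    rw [Walk.reverse_cons, walkLabel_append, ih, walkLabel_cons, walkLabel_cons, walkLabel_nil,
      mul_inv_rev, mul_one, inv_eq_of_mul_eq_one_right h1]
    rfl

/-- The total weight of all vertices of a walk. -/
def supportWeight (z : V → ℝ) {u v : V} (p : G.Walk u v) : ℝ :=
  (p.support.map z).sum

theorem supportWeight_eq_innerWeight_add {z : V → ℝ} {t v : V} (ht : z t = 0) (p : G.Walk t v) :
    supportWeight z p = innerWeight z p + z v := by
  unfold supportWeight innerWeight
  cases p with
  | nil => simp [ht]
  | cons h p =>
    rw [Walk.support_cons, List.map_cons, List.sum_cons, ht, zero_add, List.tail_cons]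
    conv_lhs => rw [← Walk.dropLast_support_concat p]
    rw [List.map_append, List.sum_append, List.map_singleton, List.sum_singleton]

theorem supportWeight_concat (z : V → ℝ) {u v w : V} (p : G.Walk u v) (h : G.Adj v w) :
    supportWeight z (p.concat h) = supportWeight z p + z w := by
  simp [supportWeight, Walk.support_concat]

theorem supportWeight_takeUntil_le [DecidableEq V] {z : V → ℝ} (hz : ∀ v, 0 ≤ z v) {u v w : V}
    (p : G.Walk u v) (h : w ∈ p.support) : supportWeight z (p.takeUntil w h) ≤ supportWeight z p := by
  unfold supportWeight
  conv_rhs => rw [← p.take_spec h, Walk.support_append]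
  rw [List.map_append, List.sum_append]
  refine le_add_of_nonneg_right (List.sum_nonneg ?_)
  simp only [List.mem_map]
  rintro _ ⟨x, -, rfl⟩
  exact hz x

theorem le_supportWeight {z : V → ℝ} (hz : ∀ v, 0 ≤ z v) {u v w : V}
    (p : G.Walk u v) (h : w ∈ p.support) : z w ≤ supportWeight z p := by
  refine List.single_le_sum ?_ _ (List.mem_map_of_mem h)
  simp only [List.mem_map]
  rintro _ ⟨x, -, rfl⟩
  exact hz x

theorem add_le_supportWeight {z : V → ℝ} (hz : ∀ v, 0 ≤ z v) {u v x y : V}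
    {p : G.Walk u v} (hp : p.IsPath) (hx : x ∈ p.support) (hy : y ∈ p.support) (hxy : x ≠ y) :
    z x + z y ≤ supportWeight z p := by
  classical
  unfold supportWeight
  rw [← List.sum_toFinset z hp.support_nodup, ← Finset.sum_pair hxy]
  refine Finset.sum_le_sum_of_subset_of_nonneg ?_ fun i _ _ => hz i
  intro w hw
  simp only [Finset.mem_insert, Finset.mem_singleton] at hw
  rcases hw with rfl | rfl <;> simpa

theorem innerWeight_congr {z z' : V → ℝ} {t v : V} (h : ∀ x, x ≠ t → z x = z' x)
    {p : G.Walk t v} (hp : p.IsPath) : innerWeight z p = innerWeight z' p := by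
  unfold innerWeight
  congr 1
  refine List.map_congr_left fun x hx => h x ?_
  rintro rfl
  have := hp.support_nodup
  rw [← Walk.cons_tail_support] at this
  exact (List.nodup_cons.mp this).1 (List.mem_of_mem_dropLast hx)

theorem IsDoublePath.ne {t v : V} {Pa Pb : G.Walk t v} (h : IsDoublePath lam Pa Pb) : v ≠ t := by
  rintro rfl
  obtain ⟨ha, hb, hne⟩ := h
  rw [Walk.isPath_iff_nil, ← Walk.eq_nil_iff_nil] at ha hb
  exact hne (by rw [ha, hb])

/-- The weight of the start vertex plays no role in the double path system. -/
theorem DoublePathFeasible.congr {z z' : V → ℝ} {t : V} (hz : DoublePathFeasible lam t z)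
    (h : ∀ x, x ≠ t → z x = z' x) (ht : 0 ≤ z' t) : DoublePathFeasible lam t z' := by
  refine ⟨fun v => ?_, fun v Pa Pb hd => ?_⟩
  · by_cases hv : v = t
    · rwa [hv]
    · rw [← h v hv]
      exact hz.1 v
  · rw [← innerWeight_congr h hd.1, ← innerWeight_congr h hd.2.1, ← h v hd.ne]
    exact hz.2 v Pa Pb hd

/-- Both full weights count the common endpoint, so one copy of `z v` is subtracted. Full weights
are easier to cut and extend than inner ones. -/
theorem DoublePathFeasible.one_le {z : V → ℝ} {t v : V} (hz : DoublePathFeasible lam t z)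
    (ht : z t = 0) {Pa Pb : G.Walk t v} (hd : IsDoublePath lam Pa Pb) :
    1 ≤ supportWeight z Pa + supportWeight z Pb - z v := by
  have := hz.2 v Pa Pb hd
  rw [supportWeight_eq_innerWeight_add ht, supportWeight_eq_innerWeight_add ht]
  linarith

end Walks

/-! ### Possible values of the deletion cost and what they say about the occurrences. -/

section Costs

variable {V Γ : Type*} {G : SimpleGraph V} {φ : G.Dart → WithZero Γ}

theorem deletionCost_halfIntegral (φ : G.Dart → WithZero Γ) : HalfIntegral (deletionCost φ) := by
  intro v
  unfold deletionCost relaxedWideEquality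
  split_ifs <;> simp

theorem deletionCost_nonneg (φ : G.Dart → WithZero Γ) (v : V) : 0 ≤ deletionCost φ v := by
  rcases deletionCost_halfIntegral φ v with h | h | h <;> rw [h] <;> norm_num

theorem deletionCost_le_one (φ : G.Dart → WithZero Γ) (v : V) : deletionCost φ v ≤ 1 := by
  rcases deletionCost_halfIntegral φ v with h | h | h <;> rw [h] <;> norm_num

theorem deletionCost_eq_zero_of_lt (h : deletionCost φ v < 1 / 2) : deletionCost φ v = 0 := by
  rcases deletionCost_halfIntegral φ v with h' | h' | h' <;> rw [h'] at h ⊢ <;> norm_num at h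

theorem deletionCost_eq_zero {v : V}
    (h : ∀ d d' : G.Dart, d.fst = v → d'.fst = v → φ d = φ d') : deletionCost φ v = 0 := by
  unfold deletionCost relaxedWideEquality
  rw [if_neg, if_neg]
  · rintro ⟨i, j, hi, hj⟩
    exact hi ((h _ _ i.2 j.2).trans hj)
  · rintro ⟨i, j, -, -, hij⟩
    exact hij (h _ _ i.2 j.2)

theorem deletionCost_le_half {v : V} (h : ∀ (d d' : G.Dart) (γ γ' : Γ), d.fst = v → d'.fst = v →
    φ d = (γ : WithZero Γ) → φ d' = (γ' : WithZero Γ) → γ = γ') : deletionCost φ v ≤ 1 / 2 := by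
  unfold deletionCost relaxedWideEquality
  rw [if_neg]
  · split_ifs <;> norm_num
  · rintro ⟨i, j, hi, hj, hij⟩
    obtain ⟨γ, hγ⟩ := WithZero.ne_zero_iff_exists.mp hi
    obtain ⟨γ', hγ'⟩ := WithZero.ne_zero_iff_exists.mp hj
    exact hij (by rw [← hγ, ← hγ', h _ _ γ γ' i.2 j.2 hγ.symm hγ'.symm])

theorem eq_of_deletionCost_eq_zero {v : V} (h : deletionCost φ v = 0) {d d' : G.Dart}
    (hd : d.fst = v) (hd' : d'.fst = v) : φ d = φ d' := by
  unfold deletionCost relaxedWideEquality at h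
  split_ifs at h with h1 h2
  · norm_num at h
  · norm_num at h
  · by_contra hne
    have h0 : ∀ e e' : {d : G.Dart // d.fst = v}, φ e.1 ≠ 0 → φ e'.1 ≠ 0 := fun e e' he he' =>
      h2 ⟨e, e', he, he'⟩
    by_cases hz : φ d = 0
    · exact h0 ⟨d', hd'⟩ ⟨d, hd⟩ (fun h' => hne (hz.trans h'.symm)) hz
    · exact h1 ⟨⟨d, hd⟩, ⟨d', hd'⟩, hz, h0 ⟨d, hd⟩ ⟨d', hd'⟩ hz, hne⟩

theorem eq_of_deletionCost_lt_one {v : V} (h : deletionCost φ v < 1) {d d' : G.Dart} {γ γ' : Γ}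
    (hd : d.fst = v) (hd' : d'.fst = v) (hγ : φ d = (γ : WithZero Γ))
    (hγ' : φ d' = (γ' : WithZero Γ)) : γ = γ' := by
  by_contra hne
  have : deletionCost φ v = 1 := by
    unfold deletionCost relaxedWideEquality
    refine if_pos ⟨⟨d, hd⟩, ⟨d', hd'⟩, ?_⟩
    simp [hγ, hγ', hne]
  linarith

end Costs

/-! ### Costs of relaxed solutions hit all double paths. -/

section Relaxed

variable {V Γ : Type*} [Group Γ] {G : SimpleGraph V} {lam : G.Dart → Γ} {t : V}
  {φ : G.Dart → WithZero Γ}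

theorem relaxedBijection_eq_zero_iff {g : Γ} {a b : WithZero Γ} :
    relaxedBijection g a b = 0 ↔ a * (g : WithZero Γ) = b := by
  unfold relaxedBijection
  split_ifs <;> simp_all

theorem RelaxedFeasible.symm_eq (h : RelaxedFeasible lam t φ) {d : G.Dart} {γ : Γ}
    (hd : φ d = (γ : WithZero Γ)) : φ d.symm = ((γ * lam d : Γ) : WithZero Γ) := by
  have := relaxedBijection_eq_zero_iff.mp (h.2 d)
  rw [← this, hd, WithZero.coe_mul]

theorem RelaxedFeasible.deletionCost_start (h : RelaxedFeasible lam t φ) :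
    deletionCost φ t = 0 :=
  deletionCost_eq_zero fun d d' hd hd' => by rw [h.1 d hd, h.1 d' hd']

/-- Integral values are carried along a path through undeleted vertices. -/
theorem RelaxedFeasible.exists_eq_mul_walkLabel (h : RelaxedFeasible lam t φ) {u v : V}
    {p : G.Walk u v} (hp : p.IsPath) (huv : u ≠ v)
    (hc : ∀ x ∈ p.support, x ≠ v → deletionCost φ x = 0) {γ : Γ}
    (hγ : ∀ d : G.Dart, d.fst = u → φ d = (γ : WithZero Γ)) :
    ∃ d : G.Dart, d.fst = v ∧ φ d = ((γ * walkLabel lam p : Γ) : WithZero Γ) := by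
  induction p generalizing γ with
  | nil => exact absurd rfl huv
  | @cons u w v hadj p ih =>
    have hd := h.symm_eq (hγ ⟨(u, w), hadj⟩ rfl)
    by_cases hwv : w = v
    · subst hwv
      obtain rfl := Walk.eq_nil_iff_nil.mpr (Walk.isPath_iff_nil.mp hp.of_cons)
      exact ⟨_, rfl, by simpa using hd⟩
    · have hw : deletionCost φ w = 0 := hc w (by simp) hwv
      obtain ⟨d, hdv, hd'⟩ := ih hp.of_cons hwv (fun x hx => hc x (by simp [hx]))
        (γ := γ * lam ⟨(u, w), hadj⟩)
        (fun d hd' => (eq_of_deletionCost_eq_zero hw hd' rfl).trans hd)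
      exact ⟨d, hdv, by rw [hd', walkLabel_cons, mul_assoc]⟩

/-- A charged `w ≠ v` on `Pa` costs at least `1/2`, so by length it is the only charged vertex on
both paths. The value of `t` reaches `w` directly along `Pa`, and also around through `Pb`, `v` and
the end of `Pa` reversed. As `w` costs less than `1`, the two values agree, which forces equal
labels. -/
theorem RelaxedFeasible.deletionCost_eq_zero_of_lt (hlam : IsLabelling lam)
    (h : RelaxedFeasible lam t φ) {v : V} {Pa Pb : G.Walk t v} (hd : IsDoublePath lam Pa Pb)
    (hlt : supportWeight (deletionCost φ) Pa + supportWeight (deletionCost φ) Pb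
      - deletionCost φ v < 1) {w : V} (hw : w ∈ Pa.support) (hwv : w ≠ v) :
    deletionCost φ w = 0 := by
  classical
  obtain ⟨ha, hb, hne⟩ := hd
  by_contra hw0
  have hvt := IsDoublePath.ne ⟨ha, hb, hne⟩
  have hnn := deletionCost_nonneg φ
  have hwt : w ≠ t := by
    rintro rfl
    exact hw0 h.deletionCost_start
  have hw2 : 1 / 2 ≤ deletionCost φ w := by
    by_contra! hc
    exact hw0 (GroupFVS.deletionCost_eq_zero_of_lt hc)
  have hwva := add_le_supportWeight hnn ha hw Pa.end_mem_support hwv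
  have hvb := le_supportWeight hnn Pb Pb.end_mem_support
  have hv0 : deletionCost φ v = 0 := GroupFVS.deletionCost_eq_zero_of_lt (by linarith)
  have hca : ∀ x ∈ Pa.support, x ≠ w → deletionCost φ x = 0 := fun x hx hxw => by
    have := add_le_supportWeight hnn ha hx hw hxw
    exact GroupFVS.deletionCost_eq_zero_of_lt (by linarith)
  have hcb : ∀ x ∈ Pb.support, deletionCost φ x = 0 := fun x hx => by
    have := le_supportWeight hnn Pb hx
    exact GroupFVS.deletionCost_eq_zero_of_lt (by linarith)
  have hstart : ∀ d : G.Dart, d.fst = t → φ d = ((1 : Γ) : WithZero Γ) := h.1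
  obtain ⟨d, hdv, hd⟩ := h.exists_eq_mul_walkLabel hb hvt.symm (fun x hx _ => hcb x hx) hstart
  obtain ⟨e, hew, he⟩ := h.exists_eq_mul_walkLabel (ha.takeUntil hw) hwt.symm
    (fun x hx hxw => hca x (Pa.support_takeUntil_subset_support hw hx) hxw) hstart
  obtain ⟨f, hfw, hf⟩ := h.exists_eq_mul_walkLabel (ha.dropUntil hw).reverse hwv.symm
    (fun x hx hxw => hca x (Pa.support_dropUntil_subset_support hw (by simpa using hx)) hxw)
    (fun d' hd' => (eq_of_deletionCost_eq_zero hv0 hd' hdv).trans hd)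
  have heq := eq_of_deletionCost_lt_one (by linarith [hnn v]) hew hfw he hf
  apply hne
  rw [walkLabel_reverse hlam, one_mul, one_mul, eq_mul_inv_iff_mul_eq, ← walkLabel_append,
    Walk.take_spec] at heq
  exact heq

/-- The deletion costs of a relaxed solution are a feasible point of the double path system. -/
theorem RelaxedFeasible.doublePathFeasible (hlam : IsLabelling lam)
    (h : RelaxedFeasible lam t φ) : DoublePathFeasible lam t (deletionCost φ) := by
  refine ⟨deletionCost_nonneg φ, fun v Pa Pb hd => ?_⟩
  by_contra! hlt
  have hlt' : supportWeight (deletionCost φ) Pa + supportWeight (deletionCost φ) Pb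
      - deletionCost φ v < 1 := by
    rw [supportWeight_eq_innerWeight_add h.deletionCost_start,
      supportWeight_eq_innerWeight_add h.deletionCost_start]
    linarith
  have hd' : IsDoublePath lam Pb Pa := ⟨hd.2.1, hd.1, hd.2.2.symm⟩
  have ha := fun x hx hxv => h.deletionCost_eq_zero_of_lt hlam hd hlt' (w := x) hx hxv
  have hb := fun x hx hxv =>
    h.deletionCost_eq_zero_of_lt hlam hd' (by linarith) (w := x) hx hxv
  -- Only `v` can be charged now, and its cost is below `1`, so both labels arrive at `v` and must
  -- agree.
  obtain ⟨d, hdv, hd1⟩ := h.exists_eq_mul_walkLabel hd.1 hd.ne.symm ha h.1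
  obtain ⟨e, hev, he1⟩ := h.exists_eq_mul_walkLabel hd.2.1 hd.ne.symm hb h.1
  have hnn := deletionCost_nonneg φ
  have h1 := le_supportWeight hnn Pa Pa.end_mem_support
  have h2 := le_supportWeight hnn Pb Pb.end_mem_support
  have := eq_of_deletionCost_lt_one (by linarith) hdv hev hd1 he1
  rw [one_mul, one_mul] at this
  exact hd.2.2 this

end Relaxed

/-! ### Threshold rounding of a feasible point, and the threshold zero. -/

section Rounding

variable {V Γ : Type*} [Group Γ] {G : SimpleGraph V} {lam : G.Dart → Γ} {t : V} {z : V → ℝ} {θ : ℝ}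

/-- `γ` is the label of a path from `t` to `v` of total weight at most `θ`. -/
def LightLabel (lam : G.Dart → Γ) (t : V) (z : V → ℝ) (θ : ℝ) (v : V) (γ : Γ) : Prop :=
  ∃ P : G.Walk t v, P.IsPath ∧ supportWeight z P ≤ θ ∧ walkLabel lam P = γ

/-- `γ` is forced on an occurrence by a light path, possibly through its edge. -/
def ForcedValue (lam : G.Dart → Γ) (t : V) (z : V → ℝ) (θ : ℝ) (d : G.Dart) (γ : Γ) : Prop :=
  LightLabel lam t z θ d.fst γ ∨ ∃ δ, LightLabel lam t z θ d.snd δ ∧ δ * lam d.symm = γ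

theorem DoublePathFeasible.label_eq (hz : DoublePathFeasible lam t z) (ht : z t = 0) {v : V}
    {P Q : G.Walk t v} (hP : P.IsPath) (hQ : Q.IsPath)
    (h : supportWeight z P + supportWeight z Q - z v < 1) :
    walkLabel lam P = walkLabel lam Q := by
  by_contra hne
  linarith [hz.one_le ht (Pa := P) (Pb := Q) ⟨hP, hQ, hne⟩]

theorem LightLabel.unique (hz : DoublePathFeasible lam t z) (ht : z t = 0) (hθ : θ < 1 / 2) {v : V}
    {γ γ' : Γ} (h : LightLabel lam t z θ v γ) (h' : LightLabel lam t z θ v γ') : γ = γ' := by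
  obtain ⟨P, hP, hPθ, rfl⟩ := h
  obtain ⟨Q, hQ, hQθ, rfl⟩ := h'
  exact hz.label_eq ht hP hQ (by linarith [hz.1 v])

/-- The extension of `P` to `v` need not be light, but its excess `z v` is the endpoint weight that
the constraint subtracts, leaving at most `2 * θ < 1`. -/
theorem LightLabel.mul_eq_of_notMem (hz : DoublePathFeasible lam t z) (ht : z t = 0)
    (hθ : θ < 1 / 2) {u v : V} (hadj : G.Adj u v) {P : G.Walk t u} (hP : P.IsPath)
    (hPθ : supportWeight z P ≤ θ) (hv : v ∉ P.support) {δ : Γ} (h : LightLabel lam t z θ v δ) :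
    walkLabel lam P * lam ⟨(u, v), hadj⟩ = δ := by
  obtain ⟨Q, hQ, hQθ, rfl⟩ := h
  rw [← walkLabel_concat]
  refine hz.label_eq ht (hP.concat hv hadj) hQ ?_
  rw [supportWeight_concat]
  linarith

theorem LightLabel.mul_eq (hlam : IsLabelling lam) (hz : DoublePathFeasible lam t z) (ht : z t = 0)
    (hθ : θ < 1 / 2) (d : G.Dart) {γ δ : Γ} (h : LightLabel lam t z θ d.fst γ)
    (h' : LightLabel lam t z θ d.snd δ) : γ * lam d = δ := by
  classical
  obtain ⟨P, hP, hPθ, rfl⟩ := id h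
  by_cases hv : d.snd ∈ P.support
  -- The prefix of `P` ending at `d.snd` avoids `d.fst`, so the edge can be used in the opposite
  -- direction.
  · have h1 : LightLabel lam t z θ d.snd (walkLabel lam (P.takeUntil _ hv)) :=
      ⟨_, hP.takeUntil hv, (supportWeight_takeUntil_le hz.1 P hv).trans hPθ, rfl⟩
    have h2 := LightLabel.mul_eq_of_notMem hz ht hθ d.adj.symm (hP.takeUntil hv)
      ((supportWeight_takeUntil_le hz.1 P hv).trans hPθ)
      (Walk.endpoint_notMem_support_takeUntil hP hv d.adj.ne) h
    rw [h1.unique hz ht hθ h'] at h2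
    rw [← h2]
    exact hlam.mul_symm_cancel' δ d
  · exact LightLabel.mul_eq_of_notMem hz ht hθ d.adj hP hPθ hv h'

theorem ForcedValue.unique (hlam : IsLabelling lam) (hz : DoublePathFeasible lam t z)
    (ht : z t = 0) (hθ : θ < 1 / 2) {d : G.Dart} {γ γ' : Γ} (h : ForcedValue lam t z θ d γ)
    (h' : ForcedValue lam t z θ d γ') : γ = γ' := by
  rcases h with h | ⟨δ, h, rfl⟩ <;> rcases h' with h' | ⟨δ', h', rfl⟩
  · exact h.unique hz ht hθ h'
  · exact (LightLabel.mul_eq hlam hz ht hθ d.symm h' h).symm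
  · exact LightLabel.mul_eq hlam hz ht hθ d.symm h h'
  · rw [h.unique hz ht hθ h']

theorem ForcedValue.symm (hlam : IsLabelling lam) {d : G.Dart} {γ : Γ}
    (h : ForcedValue lam t z θ d γ) : ForcedValue lam t z θ d.symm (γ * lam d) := by
  rcases h with h | ⟨δ, h, rfl⟩
  · exact Or.inr ⟨γ, h, by rw [Dart.symm_symm]⟩
  · refine Or.inl ?_
    rw [hlam.mul_symm_cancel' δ d]
    exact h

theorem lightLabel_start (ht : z t = 0) (hθ : 0 ≤ θ) : LightLabel lam t z θ t 1 :=
  ⟨Walk.nil, by simp, by simpa [supportWeight, ht] using hθ, by simp⟩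

/-- A forced value is the label of a path whose internal vertices are light. -/
theorem ForcedValue.exists_path (hlam : IsLabelling lam) (hz : DoublePathFeasible lam t z)
    (ht : z t = 0) (hθ : θ < 1 / 2) {d : G.Dart} {γ : Γ} (h : ForcedValue lam t z θ d γ) :
    ∃ P : G.Walk t d.fst, P.IsPath ∧ innerWeight z P ≤ θ ∧ walkLabel lam P = γ := by
  classical
  have light : ∀ δ, LightLabel lam t z θ d.fst δ →
      ∃ P : G.Walk t d.fst, P.IsPath ∧ innerWeight z P ≤ θ ∧ walkLabel lam P = δ := by
    rintro δ ⟨P, hP, hPθ, hl⟩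
    rw [supportWeight_eq_innerWeight_add ht] at hPθ
    exact ⟨P, hP, by linarith [hz.1 d.fst], hl⟩
  rcases h with h | ⟨δ, h, rfl⟩
  · exact light γ h
  · obtain ⟨Q, hQ, hQθ, hl⟩ := id h
    -- If `Q` already visits `d.fst`, it cannot be extended, but its prefix makes `d.fst` itself
    -- light, with the same value.
    by_cases hv : d.fst ∈ Q.support
    · have h1 : LightLabel lam t z θ d.fst (walkLabel lam (Q.takeUntil _ hv)) :=
        ⟨_, hQ.takeUntil hv, (supportWeight_takeUntil_le hz.1 Q hv).trans hQθ, rfl⟩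
      rw [LightLabel.mul_eq hlam hz ht hθ d.symm h h1]
      exact light _ h1
    · refine ⟨Q.concat d.adj.symm, hQ.concat hv d.adj.symm, ?_, ?_⟩
      · have := supportWeight_concat z Q d.adj.symm
        rw [supportWeight_eq_innerWeight_add ht] at this
        linarith
      · rw [walkLabel_concat, hl]
        rfl

open scoped Classical in
/-- The assignment of the forced values. -/
def forcedAssignment (lam : G.Dart → Γ) (t : V) (z : V → ℝ) (θ : ℝ) (d : G.Dart) : WithZero Γ :=
  if h : ∃ γ, ForcedValue lam t z θ d γ then (h.choose : WithZero Γ) else 0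

theorem forcedAssignment_eq_coe_iff (hlam : IsLabelling lam) (hz : DoublePathFeasible lam t z)
    (ht : z t = 0) (hθ : θ < 1 / 2) {d : G.Dart} {γ : Γ} :
    forcedAssignment lam t z θ d = (γ : WithZero Γ) ↔ ForcedValue lam t z θ d γ := by
  unfold forcedAssignment
  split_ifs with h
  · rw [WithZero.coe_inj]
    exact ⟨fun h' => h' ▸ h.choose_spec, fun h' => h.choose_spec.unique hlam hz ht hθ h'⟩
  · exact ⟨fun h' => absurd h'.symm WithZero.coe_ne_zero, fun h' => absurd ⟨γ, h'⟩ h⟩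

theorem forcedAssignment_feasible (hlam : IsLabelling lam) (hz : DoublePathFeasible lam t z)
    (ht : z t = 0) (hθ0 : 0 ≤ θ) (hθ : θ < 1 / 2) :
    RelaxedFeasible lam t (forcedAssignment lam t z θ) := by
  have key := @forcedAssignment_eq_coe_iff V Γ _ G lam t z θ hlam hz ht hθ
  refine ⟨fun d hd => key.mpr (Or.inl (by rw [hd]; exact lightLabel_start ht hθ0)), fun d => ?_⟩
  rw [relaxedBijection_eq_zero_iff]
  by_cases h : forcedAssignment lam t z θ d = 0
  · by_cases h' : forcedAssignment lam t z θ d.symm = 0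
    · rw [h, h', zero_mul]
    · obtain ⟨γ, hγ⟩ := WithZero.ne_zero_iff_exists.mp h'
      have := key.mpr ((key.mp hγ.symm).symm hlam)
      rw [Dart.symm_symm, h] at this
      exact absurd this.symm WithZero.coe_ne_zero
  · obtain ⟨γ, hγ⟩ := WithZero.ne_zero_iff_exists.mp h
    rw [← hγ, key.mpr ((key.mp hγ.symm).symm hlam), WithZero.coe_mul]

theorem deletionCost_forcedAssignment_of_lightLabel (hlam : IsLabelling lam)
    (hz : DoublePathFeasible lam t z) (ht : z t = 0) (hθ : θ < 1 / 2) {v : V} {γ : Γ}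
    (h : LightLabel lam t z θ v γ) : deletionCost (forcedAssignment lam t z θ) v = 0 := by
  have key := @forcedAssignment_eq_coe_iff V Γ _ G lam t z θ hlam hz ht hθ
  refine deletionCost_eq_zero fun d d' hd hd' => ?_
  rw [key.mpr (Or.inl (hd ▸ h)), key.mpr (Or.inl (hd' ▸ h))]

/-- A vertex of positive cost is entered by a path whose internal vertices are light. -/
theorem exists_path_of_deletionCost_ne_zero (hlam : IsLabelling lam)
    (hz : DoublePathFeasible lam t z) (ht : z t = 0) (hθ : θ < 1 / 2) {v : V}
    (h : deletionCost (forcedAssignment lam t z θ) v ≠ 0) :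
    ∃ P : G.Walk t v, P.IsPath ∧ innerWeight z P ≤ θ := by
  by_contra! hno
  refine h (deletionCost_eq_zero ?_)
  have zero : ∀ d : G.Dart, d.fst = v → forcedAssignment lam t z θ d = 0 := by
    rintro d rfl
    by_contra h0
    obtain ⟨γ, hγ⟩ := WithZero.ne_zero_iff_exists.mp h0
    obtain ⟨P, hP, hPθ, -⟩ := ForcedValue.exists_path hlam hz ht hθ
      ((forcedAssignment_eq_coe_iff hlam hz ht hθ).mp hγ.symm)
    linarith [hno P hP]
  intro d d' hd hd'
  rw [zero d hd, zero d' hd']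

/-- A vertex of cost `1` is entered by a double path whose internal vertices are light. -/
theorem exists_doublePath_of_half_lt_deletionCost (hlam : IsLabelling lam)
    (hz : DoublePathFeasible lam t z) (ht : z t = 0) (hθ : θ < 1 / 2) {v : V}
    (h : 1 / 2 < deletionCost (forcedAssignment lam t z θ) v) :
    ∃ P Q : G.Walk t v, IsDoublePath lam P Q ∧ innerWeight z P ≤ θ ∧ innerWeight z Q ≤ θ := by
  by_contra! hno
  refine h.not_ge (deletionCost_le_half fun d d' γ γ' hd hd' hγ hγ' => ?_)
  have path : ∀ (d : G.Dart) (γ : Γ), d.fst = v → forcedAssignment lam t z θ d = (γ : WithZero Γ) →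
      ∃ P : G.Walk t v, P.IsPath ∧ innerWeight z P ≤ θ ∧ walkLabel lam P = γ := by
    rintro d γ rfl hγ
    exact ForcedValue.exists_path hlam hz ht hθ
      ((forcedAssignment_eq_coe_iff hlam hz ht hθ).mp hγ)
  obtain ⟨P, hP, hPθ, rfl⟩ := path d γ hd hγ
  obtain ⟨Q, hQ, hQθ, rfl⟩ := path d' γ' hd' hγ'
  by_contra hne
  linarith [hno P Q ⟨hP, hQ, hne⟩ hPθ]

theorem deletionCost_forcedAssignment_of_path (hlam : IsLabelling lam)
    (hz : DoublePathFeasible lam t z) (ht : z t = 0) (hθ : θ < 1 / 2) {v : V} {P : G.Walk t v}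
    (hP : P.IsPath) (h : innerWeight z P + z v ≤ θ) :
    deletionCost (forcedAssignment lam t z θ) v = 0 :=
  deletionCost_forcedAssignment_of_lightLabel hlam hz ht hθ
    ⟨P, hP, (supportWeight_eq_innerWeight_add ht P).trans_le h, rfl⟩

/-- If `z v = 0`, a weightless path entering `v` makes `v` itself light, hence free. If `z v = 1/2`,
cost `1` would need a double path of length only `1/2`. -/
theorem deletionCost_forcedAssignment_le (hlam : IsLabelling lam)
    (hz : DoublePathFeasible lam t z) (ht : z t = 0) (hhalf : HalfIntegral z) (v : V) :
    deletionCost (forcedAssignment lam t z 0) v ≤ z v := by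
  rcases hhalf v with h | h | h
  · by_contra! hlt
    obtain ⟨P, hP, hP0⟩ := exists_path_of_deletionCost_ne_zero hlam hz ht (by norm_num)
      (show deletionCost (forcedAssignment lam t z 0) v ≠ 0 by linarith)
    have := deletionCost_forcedAssignment_of_path hlam hz ht (by norm_num) hP
      (show innerWeight z P + z v ≤ 0 by linarith)
    linarith
  · by_contra! hlt
    obtain ⟨P, Q, hd, hP, hQ⟩ := exists_doublePath_of_half_lt_deletionCost hlam hz ht
      (by norm_num) (h ▸ hlt)
    linarith [hz.2 v P Q hd]
  · rw [h]
    exact deletionCost_le_one _ v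

theorem propagates_of_walk {u v : V} (p : G.Walk u v) (hp : ∀ x ∈ p.support, z x = 0) {γ : Γ}
    (h : ∀ d : G.Dart, d.fst = u → Propagates lam t z d γ) (d : G.Dart) (hd : d.fst = v) :
    Propagates lam t z d (γ * walkLabel lam p) := by
  induction p generalizing γ with
  | nil => simpa using h d hd
  | @cons u w v hadj p ih =>
    rw [walkLabel_cons, ← mul_assoc]
    refine ih (fun x hx => hp x (by simp [hx])) (fun e he => ?_) hd
    exact Propagates.vertex _ e _ (Propagates.edge _ γ (h ⟨(u, w), hadj⟩ rfl)) he
      (hp w (by simp))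

theorem LightLabel.propagates (hz : ∀ v, 0 ≤ z v) {v : V} {γ : Γ}
    (h : LightLabel lam t z 0 v γ) (d : G.Dart) (hd : d.fst = v) : Propagates lam t z d γ := by
  obtain ⟨P, -, hP, rfl⟩ := h
  rw [← one_mul (walkLabel lam P)]
  exact propagates_of_walk P (fun x hx => le_antisymm ((le_supportWeight hz P hx).trans hP) (hz x))
    Propagates.start d hd

theorem forcedValue_zero_iff_propagates (hlam : IsLabelling lam)
    (hz : DoublePathFeasible lam t z) (ht : z t = 0) {d : G.Dart} {γ : Γ} :
    ForcedValue lam t z 0 d γ ↔ Propagates lam t z d γ := by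
  constructor
  · rintro (h | ⟨δ, h, rfl⟩)
    · exact h.propagates hz.1 d rfl
    · have := Propagates.edge _ _ (h.propagates hz.1 d.symm rfl)
      rwa [Dart.symm_symm] at this
  · intro h
    induction h with
    | start d hd => exact Or.inl (by rw [hd]; exact lightLabel_start ht le_rfl)
    | edge d γ _ ih => exact ih.symm hlam
    | vertex d d' γ _ hd hv ih =>
      -- The path is weightless inside and `z` vanishes at its end, so the whole path is light.
      obtain ⟨P, hP, hP0, rfl⟩ := ForcedValue.exists_path hlam hz ht (by norm_num) ih
      refine Or.inl ?_
      rw [hd]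
      exact ⟨P, hP, by rw [supportWeight_eq_innerWeight_add ht]; linarith, rfl⟩

end Rounding

/-! ### Averaging over the threshold, and existence of a half-integral optimum. -/

section Averaging

open MeasureTheory

variable {V Γ : Type*} [Group Γ] {G : SimpleGraph V} {lam : G.Dart → Γ} {t : V} {z : V → ℝ}

theorem integrable_indicator_Ico (a b c : ℝ) (s : Set ℝ) :
    IntegrableOn ((Set.Ico a b).indicator fun _ => c) s := by
  refine Integrable.integrableOn ?_
  rw [integrable_indicator_iff measurableSet_Ico]
  exact integrableOn_const (by simp)

theorem setIntegral_indicator_Ico_le {a b c : ℝ} (hab : a ≤ b) (hc : 0 ≤ c) (s : Set ℝ) :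
    ∫ x in s, (Set.Ico a b).indicator (fun _ => c) x ≤ (b - a) * c := by
  rw [integral_indicator measurableSet_Ico, Measure.restrict_restrict measurableSet_Ico,
    setIntegral_const, smul_eq_mul]
  refine mul_le_mul_of_nonneg_right ?_ hc
  refine (measureReal_mono Set.inter_subset_left (by simp)).trans ?_
  simp [Real.volume_real_Ico, hab]

/-- Over a uniformly random threshold below `1 / 2`, the expected cost of `v` is at most `z v`. -/
theorem exists_integrable_bound_deletionCost [Finite V] (hlam : IsLabelling lam)
    (hz : DoublePathFeasible lam t z) (ht : z t = 0) (v : V) :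
    ∃ f : ℝ → ℝ, IntegrableOn f (Set.Ico 0 (1 / 2)) ∧ ∫ θ in Set.Ico 0 (1 / 2), f θ ≤ z v / 2 ∧
      ∀ θ ∈ Set.Ico (0 : ℝ) (1 / 2), deletionCost (forcedAssignment lam t z θ) v ≤ f θ := by
  classical
  have := Fintype.ofFinite V
  by_cases hpath : ∃ P : G.Walk t v, P.IsPath
  swap
  · refine ⟨0, integrableOn_zero, by simpa using div_nonneg (hz.1 v) zero_le_two, fun θ hθ => ?_⟩
    by_contra! hlt
    obtain ⟨P, hP, -⟩ := exists_path_of_deletionCost_ne_zero hlam hz ht hθ.2 hlt.ne'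
    exact hpath ⟨P, hP⟩
  have : Nonempty (G.Path t v) := hpath.elim fun P hP => ⟨⟨P, hP⟩⟩
  obtain ⟨⟨P, hP⟩, hPmin⟩ := Finite.exists_min fun P : G.Path t v => innerWeight z P.1
  have hcost : ∀ θ ∈ Set.Ico (0 : ℝ) (1 / 2), θ < innerWeight z P →
      deletionCost (forcedAssignment lam t z θ) v = 0 := fun θ hθ hlt => by
    by_contra h0
    obtain ⟨Q, hQ, hQθ⟩ := exists_path_of_deletionCost_ne_zero hlam hz ht hθ.2 h0
    have := hPmin ⟨Q, hQ⟩
    dsimp only at this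
    linarith
  set a := innerWeight z P
  -- With `a` the least inner weight of a path to `v`, the cost is `0` below `a`. The case
  -- distinction is whether a path with another label than `P` enters `v` below `1/2`.
  by_cases hdouble : ∃ Q : G.Walk t v, IsDoublePath lam P Q ∧ innerWeight z Q < 1 / 2
  · have : Nonempty {Q : G.Path t v // walkLabel lam P ≠ walkLabel lam Q.1} :=
      hdouble.elim fun Q hQ => ⟨⟨⟨Q, hQ.1.2.1⟩, hQ.1.2.2⟩⟩
    obtain ⟨⟨⟨Q, hQ⟩, hne⟩, hQmin⟩ := Finite.exists_min
      fun Q : {Q : G.Path t v // walkLabel lam P ≠ walkLabel lam Q.1} => innerWeight z Q.1.1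
    have hab : a ≤ innerWeight z Q := hPmin ⟨Q, hQ⟩
    have hb : innerWeight z Q < 1 / 2 := by
      obtain ⟨Q', hQ', hlt⟩ := hdouble
      exact (hQmin ⟨⟨Q', hQ'.2.1⟩, hQ'.2.2⟩).trans_lt hlt
    have hsum : 1 ≤ a + innerWeight z Q + z v := hz.2 v P Q ⟨hP, hQ, hne⟩
    have hlight : ∀ θ ∈ Set.Ico (0 : ℝ) (1 / 2), θ < innerWeight z Q →
        deletionCost (forcedAssignment lam t z θ) v ≤ 1 / 2 := fun θ hθ hlt => by
      by_contra! hgt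
      obtain ⟨P₁, P₂, hd, h₁, h₂⟩ :=
        exists_doublePath_of_half_lt_deletionCost hlam hz ht hθ.2 hgt
      -- Two distinct labels cannot both equal that of `P`, so one of the paths has inner weight at
      -- least that of `Q`.
      have : walkLabel lam P ≠ walkLabel lam P₁ ∨ walkLabel lam P ≠ walkLabel lam P₂ := by
        by_contra! h
        exact hd.2.2 (h.1.symm.trans h.2)
      rcases this with h | h
      · exact absurd (hQmin ⟨⟨P₁, hd.1⟩, h⟩) (not_le.mpr (h₁.trans_lt hlt))
      · exact absurd (hQmin ⟨⟨P₂, hd.2.1⟩, h⟩) (not_le.mpr (h₂.trans_lt hlt))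
    set b := innerWeight z Q
    -- The cost jumps by at most `1/2` at `a` and again at `b`; the integral `(1 - a - b) / 2` is at
    -- most `z v / 2` by the constraint for `P` and `Q`.
    refine ⟨(Set.Ico a (1 / 2)).indicator (fun _ => 1 / 2) +
      (Set.Ico b (1 / 2)).indicator (fun _ => 1 / 2),
      (integrable_indicator_Ico _ _ _ _).add (integrable_indicator_Ico _ _ _ _), ?_, ?_⟩
    · simp only [Pi.add_apply]
      rw [integral_add (integrable_indicator_Ico _ _ _ _) (integrable_indicator_Ico _ _ _ _)]
      have h1 := setIntegral_indicator_Ico_le (hab.trans hb.le) (by norm_num : (0 : ℝ) ≤ 1 / 2)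
        (Set.Ico 0 (1 / 2))
      have h2 := setIntegral_indicator_Ico_le hb.le (by norm_num : (0 : ℝ) ≤ 1 / 2)
        (Set.Ico 0 (1 / 2))
      linarith
    · intro θ hθ
      simp only [Pi.add_apply, Set.indicator_apply, Set.mem_Ico, hθ.2, and_true]
      split_ifs with h1 h2 h2
      · linarith [deletionCost_le_one (forcedAssignment lam t z θ) v]
      · linarith [hlight θ hθ (not_le.mp h2)]
      · exact absurd (hab.trans h2) h1
      · linarith [hcost θ hθ (not_le.mp h1)]
  -- Cost `1` never occurs here, and from `a + z v` on the vertex is light, hence free.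
  · refine ⟨(Set.Ico a (a + z v)).indicator (fun _ => 1 / 2), integrable_indicator_Ico _ _ _ _,
      ?_, ?_⟩
    · have := setIntegral_indicator_Ico_le (by linarith [hz.1 v] : a ≤ a + z v)
        (by norm_num : (0 : ℝ) ≤ 1 / 2) (Set.Ico 0 (1 / 2))
      linarith
    · intro θ hθ
      rw [Set.indicator_apply]
      split_ifs with h
      · by_contra! hgt
        obtain ⟨P₁, P₂, hd, h₁, h₂⟩ :=
          exists_doublePath_of_half_lt_deletionCost hlam hz ht hθ.2 hgt
        by_cases h : walkLabel lam P = walkLabel lam P₁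
        · exact hdouble ⟨P₂, ⟨hP, hd.2.1, h ▸ hd.2.2⟩, h₂.trans_lt hθ.2⟩
        · exact hdouble ⟨P₁, ⟨hP, hd.1, h⟩, h₁.trans_lt hθ.2⟩
      · by_cases hθa : θ < a
        · exact (hcost θ hθ hθa).le
        · refine (deletionCost_forcedAssignment_of_path hlam hz ht hθ.2 hP ?_).le
          by_contra! hlt
          exact h ⟨not_lt.mp hθa, hlt⟩

/-- A feasible point of the double path system can be rounded to a relaxed solution. -/
theorem exists_relaxedFeasible_sum_le [Fintype V] (hlam : IsLabelling lam)
    (hz : DoublePathFeasible lam t z) (ht : z t = 0) :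
    ∃ φ, RelaxedFeasible lam t φ ∧ ∑ v, deletionCost φ v ≤ ∑ v, z v := by
  choose f hf hfint hfle using exists_integrable_bound_deletionCost hlam hz ht
  have hvol : volume.real (Set.Ico (0 : ℝ) (1 / 2)) = 1 / 2 := by
    rw [Real.volume_real_Ico]
    norm_num
  obtain ⟨θ, hθ, hle⟩ := exists_le_setAverage (μ := volume) (s := Set.Ico (0 : ℝ) (1 / 2))
    (f := fun θ => ∑ v, f v θ) (by simp) (by simp) (integrable_finsetSum _ fun v _ => hf v)
  refine ⟨forcedAssignment lam t z θ, forcedAssignment_feasible hlam hz ht hθ.1 hθ.2, ?_⟩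
  calc ∑ v, deletionCost (forcedAssignment lam t z θ) v
      ≤ ∑ v, f v θ := Finset.sum_le_sum fun v _ => hfle v θ hθ
    _ ≤ _ := hle
    -- The factor `2` is the reciprocal of the length of the threshold interval.
    _ = 2 * ∑ v, ∫ θ in Set.Ico 0 (1 / 2), f v θ := by
      rw [setAverage_eq, hvol, integral_finsetSum _ fun v _ => hf v]
      norm_num
    _ ≤ 2 * ∑ v, z v / 2 := by gcongr with v; exact hfint v
    _ = ∑ v, z v := by rw [← Finset.sum_div]; ring

theorem exists_halfIntegral_sum_le [Fintype V] (hlam : IsLabelling lam)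
    (hz : DoublePathFeasible lam t z) :
    ∃ z', DoublePathFeasible lam t z' ∧ HalfIntegral z' ∧ ∑ v, z' v ≤ ∑ v, z v := by
  classical
  have hz' : DoublePathFeasible lam t (Function.update z t 0) :=
    hz.congr (fun x hx => (Function.update_of_ne hx _ _).symm) (by simp)
  obtain ⟨φ, hφ, hle⟩ := exists_relaxedFeasible_sum_le hlam hz' (by simp)
  refine ⟨deletionCost φ, hφ.doublePathFeasible hlam, deletionCost_halfIntegral φ,
    hle.trans (Finset.sum_le_sum fun v _ => ?_)⟩
  by_cases hv : v = t
  · subst hv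
    simpa using hz.1 v
  · rw [Function.update_of_ne hv]

theorem finite_halfIntegral [Finite V] : {z : V → ℝ | HalfIntegral z}.Finite := by
  refine (Set.Finite.pi' (ι := V) (t := fun _ => ({0, 1 / 2, 1} : Set ℝ))
    fun _ => Set.toFinite _).subset fun z hz v => ?_
  simpa using hz v

theorem doublePathFeasible_one (lam : G.Dart → Γ) (t : V) :
    DoublePathFeasible lam t fun _ => 1 := by
  refine ⟨fun _ => zero_le_one, fun v Pa Pb _ => ?_⟩
  have h : ∀ P : G.Walk t v, 0 ≤ innerWeight (fun _ => (1 : ℝ)) P := fun P => by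
    simp [innerWeight]
  linarith [h Pa, h Pb]

theorem exists_halfIntegral_optimum [Fintype V] (hlam : IsLabelling lam) (t : V) :
    ∃ z, DoublePathOptimum lam t z ∧ HalfIntegral z := by
  obtain ⟨z, ⟨hhalf, hz⟩, hmin⟩ := Set.exists_min_image
    {z : V → ℝ | HalfIntegral z ∧ DoublePathFeasible lam t z} (fun z => ∑ v, z v)
    (finite_halfIntegral.subset fun z hz => hz.1)
    ⟨fun _ => 1, fun _ => by simp, doublePathFeasible_one lam t⟩
  refine ⟨z, ⟨hz, fun z' hz' => ?_⟩, hhalf⟩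
  obtain ⟨z'', hf, hh, hle⟩ := exists_halfIntegral_sum_le hlam hz'
  exact (hmin z'' ⟨hh, hf⟩).trans hle

theorem DoublePathOptimum.eq_zero [Fintype V] (hz : DoublePathOptimum lam t z) : z t = 0 := by
  classical
  have hz' : DoublePathFeasible lam t (Function.update z t 0) :=
    hz.1.congr (fun x hx => (Function.update_of_ne hx _ _).symm) (by simp)
  have h := hz.2 _ hz'
  rw [Finset.sum_update_of_mem (Finset.mem_univ t),
    ← Finset.add_sum_erase _ z (Finset.mem_univ t), Finset.sdiff_singleton_eq_erase] at h
  linarith [hz.1.1 t]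

end Averaging

end GroupFVS

end

theorem mainTheorem12 {V Γ : Type*} [Fintype V] [Group Γ] [Finite Γ] (G : SimpleGraph V)
    (lam : G.Dart → Γ) (hlam : GroupFVS.IsLabelling lam) (t : V) :
    (∃ z : V → ℝ, GroupFVS.DoublePathOptimum lam t z ∧ GroupFVS.HalfIntegral z) ∧
    ∀ z : V → ℝ, GroupFVS.DoublePathOptimum lam t z → GroupFVS.HalfIntegral z →
      ∃ φ : G.Dart → WithZero Γ,
        GroupFVS.RelaxedOptimum lam t φ ∧
        (∀ v, GroupFVS.deletionCost φ v = z v) ∧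
        ∀ (d : G.Dart) (γ : Γ), φ d = (γ : WithZero Γ) ↔ GroupFVS.Propagates lam t z d γ := by
  open GroupFVS in
  refine ⟨exists_halfIntegral_optimum hlam t, fun z hz hhalf => ?_⟩
  have ht := hz.eq_zero
  have hφ := forcedAssignment_feasible hlam hz.1 ht le_rfl (by norm_num)
  have hle := deletionCost_forcedAssignment_le hlam hz.1 ht hhalf
  -- The costs are feasible for the double path system, so optimality of `z` turns the pointwise
  -- inequality into equality.
  have hcost : ∀ v, deletionCost (forcedAssignment lam t z 0) v = z v := fun v =>
    (Finset.sum_eq_sum_iff_of_le fun v _ => hle v).mp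
      (le_antisymm (Finset.sum_le_sum fun v _ => hle v) (hz.2 _ (hφ.doublePathFeasible hlam)))
      v (Finset.mem_univ v)
  refine ⟨forcedAssignment lam t z 0, ⟨hφ, fun φ' hφ' => ?_⟩, hcost, fun d γ => ?_⟩
  · simp only [hcost]
    exact hz.2 _ (hφ'.doublePathFeasible hlam)
  · rw [forcedAssignment_eq_coe_iff hlam hz.1 ht (by norm_num),
      forcedValue_zero_iff_propagates hlam hz.1 ht]
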